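/- Let $n,m\in\mathbb{N}$, $A\in\mathbb{R}^{n\times n}$, $B\in\mathbb{R}^{n\times m}$ and $\mathcal{C}\subset\mathbb{R}^{n+m}$. Definitions. A $C$-set is a compact convex set containing the origin; a proper $C$-set is a $C$-set containing the origin in its interior. The polar set of $\mathcal{X}$ is $\mathcal{X}^*=\{x : y^Tx\le 1 \text{ for all } y\in\mathcal{X}\}$, $\oplus$ is Minkowski addition, and $P_x:\mathbb{R}^{n+m}\to\mathbb{R}^n$ is the projection $(x,u)\mapsto x$. The pair $(A,B)$ is strictly stabilizable if the uncontrollable part of the system $x^+=Ax+Bu$, that is, the linear map induced by $A$ on the quotient of $\mathbb{R}^n$ by the controllable subspace $\sum_{k\ge 0}\operatorname{range}(A^kB)$, is strictly stable (all its complex eigenvalues $\lambda$ satisfy $|\lambda|<1$). Given an initial set $\mathcal{P}_0\subseteq\mathbb{R}^n$, define $\mathcal{P}_1,\mathcal{P}_2,\ldots$ by $$\mathcal{P}_{k+1}=P_x\left(\mathcal{C}^*\oplus (A\ B)^T\mathcal{P}_k^*\right)^*,\qquad k\in\mathbb{N}.$$ Theorem. Suppose that $(A,B)$ is strictly stabilizable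 and that $\mathcal{C}$ is a proper $C$-set in $\mathbb{R}^{n+m}$. Let $\mathcal{P}_0',\mathcal{P}_0''\subseteq\mathbb{R}^n$ be such that $(\mathcal{P}_0')^*$ and $(\mathcal{P}_0'')^*$ are $C$-sets in $\mathbb{R}^n$, and let $\mathcal{P}_k'$ and $\mathcal{P}_k''$ be the corresponding iterates. Suppose that (I) $(\mathcal{P}_0'')^*\subseteq(\mathcal{P}_0')^*$; (II) $(\mathcal{P}_0')^*\subseteq(\mathcal{P}_1')^*$ or $(\mathcal{P}_1')^*\subseteq(\mathcal{P}_0')^*$; (III) $(\mathcal{P}_0'')^*\subseteq(\mathcal{P}_1'')^*$ or $(\mathcal{P}_1'')^*\subseteq(\mathcal{P}_0'')^*$. Then the sequences $\{\mathcal{P}_k'\}_{k\ge 1}$ and $\{\mathcal{P}_k''\}_{k\ge 1}$ converge, with respect to the Hausdorff distance, to proper $C$-sets $\mathcal{P}_\infty'$ and $\mathcal{P}_\infty''$ in $\mathbb{R}^n$, and these limits satisfy $$\mathcal{P}_\infty'\subseteq\mathcal{P}_\infty''.$$ -/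

import Mathlib

open scoped Pointwise

noncomputable section

namespace MinkowskiBellman

/-- The Euclidean space `ℝ^ι`. The state space is `Vec (Fin n)`, and `ℝ^{n+m}`, the space of pairs
`(x, u)`, is `Vec (Fin n ⊕ Fin m)`. -/
abbrev Vec (ι : Type) [Fintype ι] : Type := EuclideanSpace ℝ ι

/-- A `C`-set: compact, convex, and containing the origin. -/
def IsCSet {ι : Type} [Fintype ι] (X : Set (Vec ι)) : Prop :=
  IsCompact X ∧ Convex ℝ X ∧ (0 : Vec ι) ∈ X

/-- A proper `C`-set: a `C`-set containing the origin in its interior. -/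
def IsProperCSet {ι : Type} [Fintype ι] (X : Set (Vec ι)) : Prop :=
  IsCSet X ∧ (0 : Vec ι) ∈ interior X

/-- The (one-sided) polar set `X^* = {x | ∀ y ∈ X, yᵀ x ≤ 1}`. -/
def polarSet {ι : Type} [Fintype ι] (X : Set (Vec ι)) : Set (Vec ι) :=
  {x | ∀ y ∈ X, inner ℝ y x ≤ 1}

/-- The image `M X = {M x | x ∈ X}` of a set under a matrix. -/
def matImage {ι κ : Type} [Fintype ι] [Fintype κ] [DecidableEq ι]
    (M : Matrix κ ι ℝ) (X : Set (Vec ι)) : Set (Vec κ) :=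
  Matrix.toEuclideanLin M '' X

/-- The projection matrix `P_x = (I O)`, that is `(x, u) ↦ x`. -/
def projX (n m : ℕ) : Matrix (Fin n) (Fin n ⊕ Fin m) ℝ :=
  Matrix.fromCols 1 0

/-- The reachable (controllable) subspace of `x⁺ = A x + B u`: the span of the ranges of
`B, A B, A² B, …`. -/
def controllableSubspace {n m : ℕ} (A : Matrix (Fin n) (Fin n) ℝ) (B : Matrix (Fin n) (Fin m) ℝ) :
    Submodule ℝ (Vec (Fin n)) :=
  ⨆ k : ℕ, LinearMap.range (Matrix.toEuclideanLin (A ^ k * B))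

theorem controllableSubspace_le_comap {n m : ℕ}
    (A : Matrix (Fin n) (Fin n) ℝ) (B : Matrix (Fin n) (Fin m) ℝ) :
    controllableSubspace A B ≤
      (controllableSubspace A B).comap (Matrix.toEuclideanLin A) := by
  refine iSup_le fun k => ?_
  rintro _ ⟨u, rfl⟩
  refine Submodule.mem_iSup_of_mem (k + 1) ⟨u, ?_⟩
  simp [Matrix.toLpLin_apply, pow_succ', Matrix.mul_assoc]

/-- The uncontrollable part of `x⁺ = A x + B u`: the dynamics induced by `A` on the quotient of the
state space by the controllable subspace. -/
def uncontrollablePart {n m : ℕ} (A : Matrix (Fin n) (Fin n) ℝ) (B : Matrix (Fin n) (Fin m) ℝ) :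
    Module.End ℝ (Vec (Fin n) ⧸ controllableSubspace A B) :=
  (controllableSubspace A B).mapQ (controllableSubspace A B) (Matrix.toEuclideanLin A)
    (controllableSubspace_le_comap A B)

/-- Strict stability of a real linear discrete time system `z⁺ = f z`: all complex eigenvalues (the
complex roots of the characteristic polynomial) lie in the open unit disc. -/
def IsStrictlyStable {V : Type} [AddCommGroup V] [Module ℝ V] [Module.Finite ℝ V]
    (f : Module.End ℝ V) : Prop :=
  ∀ z : ℂ, Polynomial.aeval z (LinearMap.charpoly f) = 0 → ‖z‖ < 1

/-- `(A, B)` is strictly stabilizable: the dynamics of the uncontrollable part is strictly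
stable. -/
def IsStrictlyStabilizable {n m : ℕ} (A : Matrix (Fin n) (Fin n) ℝ)
    (B : Matrix (Fin n) (Fin m) ℝ) : Prop :=
  IsStrictlyStable (uncontrollablePart A B)

/-- One step of the set-dynamics: `P⁺ = P_x (C^* ⊕ (A B)ᵀ P^*)^*`. -/
def setStep {n m : ℕ} (A : Matrix (Fin n) (Fin n) ℝ) (B : Matrix (Fin n) (Fin m) ℝ)
    (C : Set (Vec (Fin n ⊕ Fin m))) (P : Set (Vec (Fin n))) : Set (Vec (Fin n)) :=
  matImage (projX n m)
    (polarSet (polarSet C + matImage (Matrix.fromCols A B).transpose (polarSet P)))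

/-- The iterates `P_0, P_1, P_2, …` of the set-dynamics from the initial set `P₀`. -/
def generatorSet {n m : ℕ} (A : Matrix (Fin n) (Fin n) ℝ) (B : Matrix (Fin n) (Fin m) ℝ)
    (C : Set (Vec (Fin n ⊕ Fin m))) (P₀ : Set (Vec (Fin n))) : ℕ → Set (Vec (Fin n))
  | 0 => P₀
  | k + 1 => setStep A B C (generatorSet A B C P₀ k)

/-- The sequence of sets `X k` converges, in the Hausdorff distance of the Euclidean norm, to the
nonempty compact set `L`. -/
def HausdorffConverges {ι : Type} [Fintype ι] (X : ℕ → Set (Vec ι)) (L : Set (Vec ι)) : Prop :=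
  L.Nonempty ∧ IsCompact L ∧
    Filter.Tendsto (fun k => Metric.hausdorffEDist (X k) L) Filter.atTop (nhds 0)

end MinkowskiBellman

end

/-!
By the bipolar theorem, a point `q` of the polar of one step `P⁺` of the set-dynamics satisfies the
Bellman equation `⟨q, x⟩ = ⟨c, (x, u)⟩ + ⟨p, A x + B u⟩` for some `c ∈ C^*`, `p ∈ P^*` and *every*
input `u`. Stabilizability provides open-loop inputs, linear in `x`, that halve the norm of every
state `x` after a fixed number `N` of steps: they cancel the component of `A ^ N x` in the
controllable subspace, and what is left is controlled by the stable quotient dynamics. Along these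
inputs, `N` Bellman equations give `‖q‖ ≤ K + ‖p‖ / 2` with `q` in the polar of the iterate `k + N`
and `p` in that of the iterate `k`, so the polars are uniformly bounded. The iterates are monotone
and contained in `P_x C`: they converge to the closure of their union if they increase, and if they
decrease to their intersection, which is the polar of a bounded set and hence has `0` in its
interior.
-/

namespace MinkowskiBellman

open Filter Topology

section PowersOfStableMaps

theorem isTopologicallyNilpotent_of_spectralRadius_lt_one {R : Type*} [NormedRing R]
    [NormedAlgebra ℂ R] [CompleteSpace R] {a : R} (ha : spectralRadius ℂ a < 1) :
    IsTopologicallyNilpotent a := by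
  obtain ⟨r, har, hr⟩ := ENNReal.lt_iff_exists_nnreal_btwn.1 ha
  have hroot : ∀ᶠ k : ℕ in atTop, (‖a ^ k‖₊ : ENNReal) ^ (1 / k : ℝ) < r :=
    (spectrum.pow_nnnorm_pow_one_div_tendsto_nhds_spectralRadius a).eventually_lt_const har
  refine squeeze_zero_norm' (a := fun k : ℕ => (r : ℝ) ^ k) ?_
    (tendsto_pow_atTop_nhds_zero_of_lt_one r.coe_nonneg (by exact_mod_cast hr))
  filter_upwards [hroot, eventually_gt_atTop 0] with k hk hk0
  rw [one_div, ENNReal.rpow_inv_lt_iff (by positivity), ENNReal.rpow_natCast] at hk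
  exact_mod_cast hk.le

section

attribute [local instance] Matrix.linftyOpNormedRing Matrix.linftyOpNormedAlgebra

theorem isTopologicallyNilpotent_of_charpoly_roots {ι : Type*} [Fintype ι] [DecidableEq ι]
    (M : Matrix ι ι ℂ) (hM : ∀ z : ℂ, M.charpoly.IsRoot z → ‖z‖ < 1) :
    IsTopologicallyNilpotent M := by
  cases isEmpty_or_nonempty ι
  · exact tendsto_const_nhds.congr fun _ => Subsingleton.elim _ _
  · refine isTopologicallyNilpotent_of_spectralRadius_lt_one <|
      spectrum.spectralRadius_lt_of_forall_lt M (r := 1) fun z hz => ?_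
    exact_mod_cast hM z (Matrix.mem_spectrum_iff_isRoot_charpoly.1 hz)

end

theorem isTopologicallyNilpotent_of_complex_charpoly_roots {ι : Type*} [Fintype ι] [DecidableEq ι]
    (M : Matrix ι ι ℝ) (hM : ∀ z : ℂ, Polynomial.aeval z M.charpoly = 0 → ‖z‖ < 1) :
    IsTopologicallyNilpotent M := by
  have hcomplex : IsTopologicallyNilpotent (M.map (algebraMap ℝ ℂ)) :=
    isTopologicallyNilpotent_of_charpoly_roots _ fun z hz => hM z <| by
      rwa [Matrix.charpoly_map, Polynomial.IsRoot, Polynomial.eval_map_algebraMap] at hz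
  have hre : Tendsto (fun k : ℕ => ((M.map (algebraMap ℝ ℂ)) ^ k).map Complex.re) atTop
      (𝓝 ((0 : Matrix ι ι ℂ).map Complex.re)) :=
    ((continuous_id.matrix_map Complex.continuous_re).tendsto _).comp hcomplex
  rw [Matrix.map_zero _ Complex.zero_re] at hre
  refine hre.congr fun k => ?_
  rw [← Matrix.map_pow]
  ext i j
  simp

theorem IsStrictlyStable.isTopologicallyNilpotent {V : Type} [NormedAddCommGroup V]
    [NormedSpace ℝ V] [FiniteDimensional ℝ V] {f : Module.End ℝ V} (hf : IsStrictlyStable f) :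
    IsTopologicallyNilpotent (Module.End.toContinuousLinearMap V f) := by
  let b := Module.finBasis ℝ V
  let e := (LinearMap.toMatrixAlgEquiv b).symm.trans (Module.End.toContinuousLinearMap V)
  have hmatrix : IsTopologicallyNilpotent (LinearMap.toMatrixAlgEquiv b f) :=
    isTopologicallyNilpotent_of_complex_charpoly_roots _ fun z hz => hf z <| by
      rwa [← LinearMap.charpoly_toMatrix f b]
  have he : Continuous e := e.toLinearMap.continuous_of_finiteDimensional
  simpa [e] using hmatrix.map he

end PowersOfStableMaps

section QuotientNorm

theorem eventually_norm_mkQ_pow_le {E : Type} [NormedAddCommGroup E] [NormedSpace ℝ E]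
    [FiniteDimensional ℝ E] {A : Module.End ℝ E} {R : Submodule ℝ E} {hR : R ≤ R.comap A}
    (hA : IsStrictlyStable (R.mapQ R A hR)) {c : ℝ} (hc : 0 < c) :
    ∀ᶠ N : ℕ in atTop, ∀ x, ‖R.mkQ ((A ^ N) x)‖ ≤ c * ‖x‖ := by
  have : IsClosed (R : Set E) := R.closed_of_finiteDimensional
  have hpow := hA.isTopologicallyNilpotent.norm
  rw [norm_zero] at hpow
  filter_upwards [hpow.eventually_le_const hc] with N hN x
  have hcomm : R.mkQ ((A ^ N) x) =
      (Module.End.toContinuousLinearMap _ (R.mapQ R A hR) ^ N) (R.mkQ x) := by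
    rw [← map_pow, ← Submodule.mapQ_pow]
    rfl
  calc ‖R.mkQ ((A ^ N) x)‖
    _ ≤ c * ‖R.mkQ x‖ := hcomm ▸ ContinuousLinearMap.le_of_opNorm_le _ hN _
    _ ≤ c * ‖x‖ := by gcongr; exact Submodule.Quotient.norm_mk_le R x

theorem norm_starProjection_orthogonal_le_norm_mkQ {𝕜 E : Type*} [RCLike 𝕜]
    [NormedAddCommGroup E] [InnerProductSpace 𝕜 E] (R : Submodule 𝕜 E)
    [R.HasOrthogonalProjection] (y : E) :
    ‖Rᗮ.starProjection y‖ ≤ ‖R.mkQ y‖ := by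
  refine le_of_forall_pos_le_add fun ε hε => ?_
  obtain ⟨z, hz, hzε⟩ := Submodule.Quotient.norm_mk_lt (R.mkQ y) hε
  have hproj : Rᗮ.starProjection y = Rᗮ.starProjection z := by
    rw [← sub_eq_zero, ← map_sub, Submodule.starProjection_apply_eq_zero_iff,
      Submodule.orthogonal_orthogonal]
    exact (Submodule.Quotient.eq R).1 hz.symm
  exact hproj ▸ (Rᗮ.norm_starProjection_apply_le z).trans hzε.le

end QuotientNorm

section Steering

/-- The state reached after `k` steps of `x⁺ = A x + B u`, as a linear function of the initial
state `x`, when the input applied at time `i` is `U i x`. -/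
def openLoopState {R E F : Type*} [Semiring R] [AddCommMonoid E] [Module R E] [AddCommMonoid F]
    [Module R F] (A : E →ₗ[R] E) (B : F →ₗ[R] E) (U : ℕ → E →ₗ[R] F) : ℕ → E →ₗ[R] E
  | 0 => .id
  | k + 1 => A ∘ₗ openLoopState A B U k + B ∘ₗ U k

theorem openLoopState_apply {R E F : Type*} [Semiring R] [AddCommMonoid E] [Module R E]
    [AddCommMonoid F] [Module R F] (A : E →ₗ[R] E) (B : F →ₗ[R] E) (U : ℕ → E →ₗ[R] F) (N : ℕ)
    (x : E) :
    openLoopState A B U N x =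
      (A ^ N) x + ∑ k ∈ Finset.range N, (A ^ (N - 1 - k)) (B (U k x)) := by
  induction N with
  | zero => simp [openLoopState]
  | succ N ih =>
    have hshift : ∀ k ∈ Finset.range N,
        A ((A ^ (N - 1 - k)) (B (U k x))) = (A ^ (N - k)) (B (U k x)) := fun k hk => by
      rw [← Module.End.mul_apply, ← pow_succ',
        show N - 1 - k + 1 = N - k by have := Finset.mem_range.1 hk; omega]
    simp only [openLoopState, LinearMap.add_apply, LinearMap.comp_apply, ih, map_add, map_sum,
      Finset.sum_range_succ, Finset.sum_congr rfl hshift, pow_succ', Module.End.mul_apply,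
      Nat.add_sub_cancel, Nat.sub_self, pow_zero, Module.End.one_apply, add_assoc]

theorem exists_sum_comp_eq_of_le_iSup_range {K E F : Type*} [DivisionRing K] [AddCommGroup E]
    [Module K E] [AddCommGroup F] [Module K F] (S : ℕ → F →ₗ[K] E) {R : Submodule K E}
    [FiniteDimensional K R] (hR : R ≤ ⨆ k, LinearMap.range (S k)) :
    ∃ (V : ℕ → R →ₗ[K] F) (N₀ : ℕ), ∀ N ≥ N₀, ∀ r,
      ∑ k ∈ Finset.range N, S k (V k r) = r := by
  let Φ : (ℕ →₀ F) →ₗ[K] E := Finsupp.lsum ℕ S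
  have hΦ : R ≤ LinearMap.range Φ := hR.trans <| iSup_le fun k => by
    rintro _ ⟨u, rfl⟩
    exact ⟨Finsupp.single k u, by simp [Φ]⟩
  obtain ⟨h, hh⟩ := Module.projective_lifting_property Φ.rangeRestrict (Submodule.inclusion hΦ)
    Φ.surjective_rangeRestrict
  have hlift (r : R) : Φ (h r) = r := congrArg Subtype.val (LinearMap.congr_fun hh r)
  let b := Module.finBasis K R
  refine ⟨fun k => Finsupp.lapply k ∘ₗ h,
    Finset.univ.sup fun i => (h (b i)).support.sup Nat.succ, fun N hN r => ?_⟩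
  suffices hmap : ∑ k ∈ Finset.range N, S k ∘ₗ Finsupp.lapply k ∘ₗ h = R.subtype by
    simpa using LinearMap.congr_fun hmap r
  refine b.ext fun i => ?_
  have hsupp : (h (b i)).support ⊆ Finset.range N := fun k hk => Finset.mem_range.2 <|
    (Finset.le_sup (f := Nat.succ) hk).trans <|
      (Finset.le_sup (f := fun i => (h (b i)).support.sup Nat.succ) (Finset.mem_univ i)).trans hN
  rw [Submodule.subtype_apply, ← hlift (b i), Finsupp.lsum_apply,
    Finsupp.sum_of_support_subset _ hsupp _ fun k _ => map_zero (S k)]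
  simp

theorem exists_norm_openLoopState_le {E : Type} [NormedAddCommGroup E] [InnerProductSpace ℝ E]
    [FiniteDimensional ℝ E] {F : Type*} [AddCommGroup F] [Module ℝ F] (A : Module.End ℝ E)
    (B : F →ₗ[ℝ] E) {R : Submodule ℝ E} (hR : R ≤ R.comap A)
    (hreach : R ≤ ⨆ k, LinearMap.range ((A ^ k) ∘ₗ B)) (hA : IsStrictlyStable (R.mapQ R A hR))
    {c : ℝ} (hc : 0 < c) :
    ∃ (U : ℕ → E →ₗ[ℝ] F), ∃ N > 0, ∀ x, ‖openLoopState A B U N x‖ ≤ c * ‖x‖ := by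
  obtain ⟨V, N₀, hV⟩ := exists_sum_comp_eq_of_le_iSup_range (fun k => (A ^ k) ∘ₗ B) hreach
  obtain ⟨N, hN, hNpos, hN₀⟩ := ((eventually_norm_mkQ_pow_le hA hc).and
    ((eventually_gt_atTop 0).and (eventually_ge_atTop N₀))).exists
  let target : E →ₗ[ℝ] R := R.orthogonalProjectionOnto.toLinearMap ∘ₗ (A ^ N)
  -- The inputs cancel exactly the component of `A ^ N x` in `R`.
  refine ⟨fun k => -(V (N - 1 - k) ∘ₗ target), N, hNpos, fun x => ?_⟩
  have hfinal : openLoopState A B (fun k => -(V (N - 1 - k) ∘ₗ target)) N x =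
      Rᗮ.starProjection ((A ^ N) x) := by
    have hsum : ∑ k ∈ Finset.range N, (A ^ (N - 1 - k)) (B (V (N - 1 - k) (target x))) =
        R.starProjection ((A ^ N) x) :=
      (Finset.sum_range_reflect (fun k => (A ^ k) (B (V k (target x)))) N).trans
        (hV N hN₀ (target x))
    rw [openLoopState_apply]
    simp only [LinearMap.neg_apply, map_neg, Finset.sum_neg_distrib, LinearMap.comp_apply, hsum]
    rw [← sub_eq_add_neg, sub_eq_iff_eq_add',
      R.starProjection_add_starProjection_orthogonal]
  exact hfinal ▸ (norm_starProjection_orthogonal_le_norm_mkQ R _).trans (hN x)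

end Steering

section BellmanInequality

theorem isBounded_iUnion_of_norm_le_add_mul {E : Type*} [SeminormedAddCommGroup E]
    {Q : ℕ → Set E} {N : ℕ} (hN : 0 < N) (hQ : ∀ k < N, Bornology.IsBounded (Q k)) {c K : ℝ}
    (hc : 0 ≤ c) (hc' : c < 1) (h : ∀ k, ∀ q ∈ Q (k + N), ∃ p ∈ Q k, ‖q‖ ≤ K + c * ‖p‖) :
    Bornology.IsBounded (⋃ k, Q k) := by
  obtain ⟨r₀, hr₀⟩ := isBounded_iff_forall_norm_le.1 <|
    (Bornology.isBounded_biUnion (Set.finite_Iio N)).2 hQ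
  obtain ⟨r, hr₀r, hKr⟩ : ∃ r, r₀ ≤ r ∧ K + c * r ≤ r := by
    refine ⟨max r₀ (K / (1 - c)), le_max_left _ _, ?_⟩
    have := (div_le_iff₀ (sub_pos.2 hc')).1 (le_max_right r₀ (K / (1 - c)))
    linarith
  have hbound : ∀ k, ∀ q ∈ Q k, ‖q‖ ≤ r := by
    intro k
    induction k using Nat.strong_induction_on with
    | h k ih =>
      intro q hq
      obtain hk | hk := lt_or_ge k N
      · exact (hr₀ q (Set.mem_biUnion hk hq)).trans hr₀r
      · obtain ⟨p, hp, hqp⟩ := h (k - N) q (by rwa [Nat.sub_add_cancel hk])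
        calc ‖q‖ ≤ K + c * ‖p‖ := hqp
          _ ≤ K + c * r := by gcongr; exact ih (k - N) (by omega) p hp
          _ ≤ r := hKr
  refine isBounded_iff_forall_norm_le.2 ⟨r, fun q hq => ?_⟩
  obtain ⟨k, hk⟩ := Set.mem_iUnion.1 hq
  exact hbound k q hk

variable {F : Type*} [NormedAddCommGroup F] [NormedSpace ℝ F] {s : ℝ}

theorem exists_inner_le_add_inner_openLoopState {E : Type*} [NormedAddCommGroup E]
    [InnerProductSpace ℝ E] [FiniteDimensional ℝ E] {A : Module.End ℝ E} {B : F →ₗ[ℝ] E}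
    {Q : ℕ → Set E} (hs : 0 ≤ s)
    (hQ : ∀ k, ∀ q ∈ Q (k + 1), ∃ p ∈ Q k, ∀ x u, inner ℝ q x ≤
      s * ‖(x, u)‖ + inner ℝ p (A x + B u)) (U : ℕ → E →ₗ[ℝ] F) (N : ℕ) :
    ∃ K ≥ 0, ∀ k, ∀ q ∈ Q (k + N), ∃ p ∈ Q k, ∀ x, inner ℝ q x ≤
      K * ‖x‖ + inner ℝ p (openLoopState A B U N x) := by
  induction N with
  | zero => exact ⟨0, le_rfl, fun k q hq => ⟨q, hq, fun x => by simp [openLoopState]⟩⟩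
  | succ N ih =>
    obtain ⟨K, hK, ih⟩ := ih
    let last := ((openLoopState A B U N).prod (U N)).toContinuousLinearMap
    refine ⟨K + s * ‖last‖, by positivity, fun k q hq => ?_⟩
    obtain ⟨p', hp', hqp'⟩ := ih (k + 1) q (by rwa [Nat.succ_add_eq_add_succ])
    obtain ⟨p, hp, hp'p⟩ := hQ k p' hp'
    refine ⟨p, hp, fun x => ?_⟩
    calc inner ℝ q x
      _ ≤ K * ‖x‖ + inner ℝ p' (openLoopState A B U N x) := hqp' x
      _ ≤ K * ‖x‖ + (s * ‖last x‖ + inner ℝ p (openLoopState A B U (N + 1) x)) := by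
        gcongr
        exact hp'p _ _
      _ ≤ K * ‖x‖ + (s * (‖last‖ * ‖x‖) + inner ℝ p (openLoopState A B U (N + 1) x)) := by
        gcongr
        exact last.le_opNorm x
      _ = (K + s * ‖last‖) * ‖x‖ + inner ℝ p (openLoopState A B U (N + 1) x) := by ring

theorem isBounded_iUnion_of_inner_le {E : Type} [NormedAddCommGroup E] [InnerProductSpace ℝ E]
    [FiniteDimensional ℝ E] {A : Module.End ℝ E} {B : F →ₗ[ℝ] E} {R : Submodule ℝ E}
    (hR : R ≤ R.comap A) (hreach : R ≤ ⨆ k, LinearMap.range ((A ^ k) ∘ₗ B))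
    (hA : IsStrictlyStable (R.mapQ R A hR)) {Q : ℕ → Set E}
    (hbounded : ∀ k, Bornology.IsBounded (Q k)) (hs : 0 ≤ s)
    (hQ : ∀ k, ∀ q ∈ Q (k + 1), ∃ p ∈ Q k, ∀ x u, inner ℝ q x ≤
      s * ‖(x, u)‖ + inner ℝ p (A x + B u)) :
    Bornology.IsBounded (⋃ k, Q k) := by
  obtain ⟨U, N, hN, hU⟩ := exists_norm_openLoopState_le A B hR hreach hA one_half_pos
  obtain ⟨K, hK, hqK⟩ := exists_inner_le_add_inner_openLoopState hs hQ U N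
  refine isBounded_iUnion_of_norm_le_add_mul hN (fun k _ => hbounded k) one_half_pos.le
    one_half_lt_one (K := K) fun k q hq => ?_
  obtain ⟨p, hp, hqp⟩ := hqK k q hq
  refine ⟨p, hp, ?_⟩
  obtain rfl | hq0 := eq_or_ne q 0
  · rw [norm_zero]
    positivity
  refine le_of_mul_le_mul_right ?_ (norm_pos_iff.2 hq0)
  calc ‖q‖ * ‖q‖ = inner ℝ q q := (real_inner_self_eq_norm_mul_norm q).symm
    _ ≤ K * ‖q‖ + inner ℝ p (openLoopState A B U N q) := hqp q
    _ ≤ K * ‖q‖ + ‖p‖ * (1 / 2 * ‖q‖) := by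
      gcongr
      exact (real_inner_le_norm _ _).trans (by gcongr; exact hU q)
    _ = (K + 1 / 2 * ‖p‖) * ‖q‖ := by ring

end BellmanInequality

section HausdorffLimits

theorem tendsto_hausdorffEDist_iInter_of_antitone {α : Type*} [EMetricSpace α] {X : ℕ → Set α}
    (hX : Antitone X) (hc : ∀ k, IsCompact (X k)) :
    Tendsto (fun k => Metric.hausdorffEDist (X k) (⋂ k, X k)) atTop (𝓝 0) := by
  refine ENNReal.tendsto_nhds_zero.2 fun ε hε => ?_
  have hopen : IsOpen {x | Metric.infEDist x (⋂ k, X k) < ε} :=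
    isOpen_lt Metric.continuous_infEDist continuous_const
  obtain ⟨K, hK⟩ := exists_subset_nhds_of_isCompact (directed_of_isDirected_le hX) hc
    fun x hx => hopen.mem_nhds (by simpa [Metric.infEDist_zero_of_mem hx] using hε)
  filter_upwards [eventually_ge_atTop K] with k hk
  refine Metric.hausdorffEDist_le_of_infEDist (fun x hx => (hK (hX hk hx)).le) fun x hx => ?_
  exact (Metric.infEDist_zero_of_mem (Set.iInter_subset X k hx)).trans_le zero_le

theorem tendsto_hausdorffEDist_closure_iUnion_of_monotone {α : Type*} [PseudoEMetricSpace α]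
    {X : ℕ → Set α} (hX : Monotone X) (hc : IsCompact (closure (⋃ k, X k))) :
    Tendsto (fun k => Metric.hausdorffEDist (X k) (closure (⋃ k, X k))) atTop (𝓝 0) := by
  refine ENNReal.tendsto_nhds_zero.2 fun ε hε => ?_
  have hcover : closure (⋃ k, X k) ⊆ ⋃ k, {x | Metric.infEDist x (X k) < ε} := fun x hx => by
    obtain ⟨y, hy, hxy⟩ := EMetric.mem_closure_iff.1 hx ε hε
    obtain ⟨k, hk⟩ := Set.mem_iUnion.1 hy
    exact Set.mem_iUnion.2 ⟨k, (Metric.infEDist_le_edist_of_mem hk).trans_lt hxy⟩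
  obtain ⟨K, hK⟩ := hc.elim_directed_cover (fun k => {x | Metric.infEDist x (X k) < ε})
    (fun k => isOpen_lt Metric.continuous_infEDist continuous_const) hcover
    (directed_of_isDirected_le fun i j hij x hx => (Metric.infEDist_anti (hX hij)).trans_lt hx)
  filter_upwards [eventually_ge_atTop K] with k hk
  refine Metric.hausdorffEDist_le_of_infEDist (fun x hx => ?_) fun x hx =>
    ((Metric.infEDist_anti (hX hk)).trans_lt (hK hx)).le
  exact (Metric.infEDist_zero_of_mem <|
    subset_closure (Set.mem_iUnion_of_mem k hx)).trans_le zero_le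

theorem subset_closure_of_tendsto_hausdorffEDist {α β : Type*} [PseudoEMetricSpace α]
    {l : Filter β} [l.NeBot] {X Y : β → Set α} {L M : Set α}
    (hX : Tendsto (fun k => Metric.hausdorffEDist (X k) L) l (𝓝 0))
    (hY : Tendsto (fun k => Metric.hausdorffEDist (Y k) M) l (𝓝 0)) (h : ∀ k, X k ⊆ Y k) :
    L ⊆ closure M := by
  intro x hx
  rw [Metric.mem_closure_iff_infEDist_zero]
  have hlim := hX.add hY
  rw [add_zero] at hlim
  refine le_antisymm (ge_of_tendsto' hlim fun k => ?_) zero_le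
  calc Metric.infEDist x M
    _ ≤ Metric.infEDist x (Y k) + Metric.hausdorffEDist (Y k) M :=
      Metric.infEDist_le_infEDist_add_hausdorffEDist
    _ ≤ Metric.infEDist x (X k) + Metric.hausdorffEDist (Y k) M := by
      gcongr ?_ + _; exact Metric.infEDist_anti (h k)
    _ ≤ Metric.hausdorffEDist (X k) L + Metric.hausdorffEDist (Y k) M := by
      gcongr; exact Metric.hausdorffEDist_comm (s := L) ▸
        Metric.infEDist_le_hausdorffEDist_of_mem hx

theorem HausdorffConverges.subset {ι : Type} [Fintype ι] {X Y : ℕ → Set (Vec ι)}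
    {L M : Set (Vec ι)} (hX : HausdorffConverges X L) (hY : HausdorffConverges Y M)
    (h : ∀ k, X k ⊆ Y k) : L ⊆ M :=
  hY.2.1.isClosed.closure_eq ▸ subset_closure_of_tendsto_hausdorffEDist hX.2.2 hY.2.2 h

end HausdorffLimits

section Polar

variable {ι κ : Type} [Fintype ι] [Fintype κ]

theorem polarSet_anti {X Y : Set (Vec ι)} (h : X ⊆ Y) : polarSet Y ⊆ polarSet X :=
  fun _ hx y hy => hx y (h hy)

theorem polarSet_eq_biInter (X : Set (Vec ι)) :
    polarSet X = ⋂ y ∈ X, {x | inner ℝ y x ≤ 1} := by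
  ext
  simp [polarSet]

theorem polarSet_iUnion {α : Sort*} (X : α → Set (Vec ι)) :
    polarSet (⋃ k, X k) = ⋂ k, polarSet (X k) := by
  simp only [polarSet_eq_biInter, Set.biInter_iUnion]

theorem zero_mem_polarSet (X : Set (Vec ι)) : (0 : Vec ι) ∈ polarSet X := by
  simp [polarSet]

theorem isClosed_polarSet (X : Set (Vec ι)) : IsClosed (polarSet X) :=
  polarSet_eq_biInter X ▸
    isClosed_biInter fun y _ => isClosed_le (by fun_prop) continuous_const

theorem convex_polarSet (X : Set (Vec ι)) : Convex ℝ (polarSet X) :=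
  polarSet_eq_biInter X ▸
    convex_iInter₂ fun y _ => convex_halfSpace_le (innerₛₗ ℝ y).isLinear 1

theorem polarSet_polarSet {X : Set (Vec ι)} (hc : IsClosed X) (hconv : Convex ℝ X)
    (h0 : (0 : Vec ι) ∈ X) : polarSet (polarSet X) = X := by
  refine Set.Subset.antisymm (fun x hx => ?_) fun x hx y hy => real_inner_comm x y ▸ hy x hx
  by_contra hxX
  obtain ⟨f, u, hf, hu⟩ := geometric_hahn_banach_closed_point hconv hc hxX
  have hu0 : 0 < u := by simpa using hf 0 h0
  let y := (InnerProductSpace.toDual ℝ (Vec ι)).symm f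
  have hy (z : Vec ι) : inner ℝ (u⁻¹ • y) z = u⁻¹ * f z := by
    rw [real_inner_smul_left, InnerProductSpace.toDual_symm_apply]
  have hmem : u⁻¹ • y ∈ polarSet X := fun z hz => by
    rw [real_inner_comm, hy, inv_mul_le_one₀ hu0]
    exact (hf z hz).le
  have hle := hx _ hmem
  rw [hy, inv_mul_le_one₀ hu0] at hle
  exact hle.not_gt hu

theorem IsCSet.polarSet_polarSet {X : Set (Vec ι)} (hX : IsCSet X) :
    polarSet (polarSet X) = X :=
  MinkowskiBellman.polarSet_polarSet hX.1.isClosed hX.2.1 hX.2.2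

theorem norm_le_of_mem_polarSet {X : Set (Vec ι)} {ε : ℝ} (hε : 0 < ε)
    (hX : Metric.closedBall 0 ε ⊆ X) {y : Vec ι} (hy : y ∈ polarSet X) : ‖y‖ ≤ ε⁻¹ := by
  obtain rfl | hy0 := eq_or_ne y 0
  · simpa using hε.le
  have hpos : 0 < ‖y‖ := norm_pos_iff.2 hy0
  have hmem : (ε * ‖y‖⁻¹) • y ∈ X := hX <| by
    rw [mem_closedBall_zero_iff, norm_smul, Real.norm_of_nonneg (by positivity), mul_assoc,
      inv_mul_cancel₀ hpos.ne', mul_one]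
  rw [← one_div, le_div_iff₀ hε]
  calc ‖y‖ * ε = inner ℝ ((ε * ‖y‖⁻¹) • y) y := by
        rw [real_inner_smul_left, real_inner_self_eq_norm_sq]
        field_simp
    _ ≤ 1 := hy _ hmem

theorem isCSet_polarSet {X : Set (Vec ι)} (h : (0 : Vec ι) ∈ interior X) :
    IsCSet (polarSet X) := by
  obtain ⟨ε, hε, hX⟩ := Metric.nhds_basis_closedBall.mem_iff.1 (mem_interior_iff_mem_nhds.1 h)
  exact ⟨Metric.isCompact_of_isClosed_isBounded (isClosed_polarSet X) <|
      isBounded_iff_forall_norm_le.2 ⟨ε⁻¹, fun _ => norm_le_of_mem_polarSet hε hX⟩,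
    convex_polarSet X, zero_mem_polarSet X⟩

theorem zero_mem_interior_polarSet {X : Set (Vec ι)} (h : Bornology.IsBounded X) :
    (0 : Vec ι) ∈ interior (polarSet X) := by
  obtain ⟨r, hr, hX⟩ := h.exists_pos_norm_le
  refine mem_interior_iff_mem_nhds.2 <|
    mem_of_superset (Metric.closedBall_mem_nhds 0 (inv_pos.2 hr)) fun x hx y hy => ?_
  calc inner ℝ y x ≤ ‖y‖ * ‖x‖ := real_inner_le_norm y x
    _ ≤ r * r⁻¹ := by gcongr; exacts [hX y hy, mem_closedBall_zero_iff.1 hx]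
    _ = 1 := mul_inv_cancel₀ hr.ne'

theorem IsCSet.add {X Y : Set (Vec ι)} (hX : IsCSet X) (hY : IsCSet Y) : IsCSet (X + Y) :=
  ⟨hX.1.add hY.1, hX.2.1.add hY.2.1, ⟨0, hX.2.2, 0, hY.2.2, add_zero 0⟩⟩

theorem IsCSet.matImage [DecidableEq ι] {X : Set (Vec ι)} (hX : IsCSet X) (M : Matrix κ ι ℝ) :
    IsCSet (matImage M X) :=
  ⟨hX.1.image (LinearMap.continuous_of_finiteDimensional _), hX.2.1.linear_image _,
    ⟨0, hX.2.2, map_zero _⟩⟩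

theorem inner_toEuclideanLin_transpose [DecidableEq ι] [DecidableEq κ] (M : Matrix κ ι ℝ)
    (x : Vec ι) (y : Vec κ) :
    inner ℝ (Matrix.toEuclideanLin M.transpose y) x = inner ℝ y (Matrix.toEuclideanLin M x) := by
  rw [← Matrix.conjTranspose_eq_transpose_of_trivial,
    Matrix.toEuclideanLin_conjTranspose_eq_adjoint, LinearMap.adjoint_inner_left]

theorem polarSet_matImage [DecidableEq ι] [DecidableEq κ] (M : Matrix κ ι ℝ) (X : Set (Vec ι)) :
    polarSet (matImage M X) = Matrix.toEuclideanLin M.transpose ⁻¹' polarSet X := by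
  ext y
  refine Set.forall_mem_image.trans (forall₂_congr fun x _ => ?_)
  rw [real_inner_comm, ← inner_toEuclideanLin_transpose, real_inner_comm]

end Polar

section Dynamics

theorem toEuclideanLin_fromCols_sumEquivProd_symm {ι κ μ : Type} [Fintype κ] [Fintype μ]
    [DecidableEq κ] [DecidableEq μ] (M₁ : Matrix ι κ ℝ) (M₂ : Matrix ι μ ℝ)
    (z : Vec κ × Vec μ) :
    Matrix.toEuclideanLin (Matrix.fromCols M₁ M₂) (EuclideanSpace.sumEquivProd.symm z) =
      Matrix.toEuclideanLin M₁ z.1 + Matrix.toEuclideanLin M₂ z.2 := by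
  ext i
  simp [Matrix.toLpLin_apply, Matrix.mulVec, dotProduct]

variable {n m : ℕ}

theorem toEuclideanLin_projX_sumEquivProd_symm (z : Vec (Fin n) × Vec (Fin m)) :
    Matrix.toEuclideanLin (projX n m) (EuclideanSpace.sumEquivProd.symm z) = z.1 := by
  rw [projX, toEuclideanLin_fromCols_sumEquivProd_symm]
  simp

theorem controllableSubspace_eq_iSup_range (A : Matrix (Fin n) (Fin n) ℝ)
    (B : Matrix (Fin n) (Fin m) ℝ) :
    controllableSubspace A B =
      ⨆ k, LinearMap.range ((Matrix.toEuclideanLin A ^ k) ∘ₗ Matrix.toEuclideanLin B) := by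
  refine iSup_congr fun k => ?_
  rw [← Matrix.toLpLin_pow, ← Matrix.toLpLin_mul]

variable {A : Matrix (Fin n) (Fin n) ℝ} {B : Matrix (Fin n) (Fin m) ℝ}
  {C : Set (Vec (Fin n ⊕ Fin m))}

theorem setStep_subset_setStep {P P' : Set (Vec (Fin n))} (h : polarSet P' ⊆ polarSet P) :
    setStep A B C P ⊆ setStep A B C P' :=
  Set.image_mono (polarSet_anti (Set.add_subset_add_left (Set.image_mono h)))

theorem polarSet_polarSet_add_subset (hC : IsCSet C) (P : Set (Vec (Fin n))) :
    polarSet (polarSet C + matImage (Matrix.fromCols A B).transpose (polarSet P)) ⊆ C := by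
  conv_rhs => rw [← hC.polarSet_polarSet]
  exact polarSet_anti fun c hc => ⟨c, hc, 0, ⟨0, zero_mem_polarSet P, map_zero _⟩, add_zero c⟩

theorem setStep_subset_matImage_projX (hC : IsCSet C) (P : Set (Vec (Fin n))) :
    setStep A B C P ⊆ matImage (projX n m) C :=
  Set.image_mono (polarSet_polarSet_add_subset hC P)

theorem isProperCSet_setStep (hC : IsProperCSet C) {P : Set (Vec (Fin n))}
    (hP : IsCSet (polarSet P)) : IsProperCSet (setStep A B C P) := by
  have hsum := (isCSet_polarSet hC.2).add (hP.matImage (Matrix.fromCols A B).transpose)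
  have hpolar : IsCSet (polarSet (polarSet C +
      matImage (Matrix.fromCols A B).transpose (polarSet P))) :=
    ⟨hC.1.1.of_isClosed_subset (isClosed_polarSet _) (polarSet_polarSet_add_subset hC.1 P),
      convex_polarSet _, zero_mem_polarSet _⟩
  have hopen : IsOpenMap (Matrix.toEuclideanLin (projX n m)) :=
    LinearMap.isOpenMap_of_finiteDimensional _ fun x =>
      ⟨_, toEuclideanLin_projX_sumEquivProd_symm (x, 0)⟩
  exact ⟨hpolar.matImage _, hopen.image_interior_subset _
    ⟨0, zero_mem_interior_polarSet hsum.1.isBounded, map_zero _⟩⟩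

theorem exists_inner_eq_add_of_mem_polarSet_setStep (hC : IsProperCSet C)
    {P : Set (Vec (Fin n))} (hP : IsCSet (polarSet P)) {q : Vec (Fin n)}
    (hq : q ∈ polarSet (setStep A B C P)) :
    ∃ c ∈ polarSet C, ∃ p ∈ polarSet P, ∀ z : Vec (Fin n) × Vec (Fin m),
      inner ℝ q z.1 = inner ℝ c (EuclideanSpace.sumEquivProd.symm z) +
        inner ℝ p (Matrix.toEuclideanLin A z.1 + Matrix.toEuclideanLin B z.2) := by
  have hsum := (isCSet_polarSet hC.2).add (hP.matImage (Matrix.fromCols A B).transpose)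
  rw [setStep, polarSet_matImage, hsum.polarSet_polarSet] at hq
  obtain ⟨c, hc, _, ⟨p, hp, rfl⟩, hcp⟩ := Set.mem_add.1 hq
  refine ⟨c, hc, p, hp, fun z => ?_⟩
  rw [← toEuclideanLin_fromCols_sumEquivProd_symm, ← inner_toEuclideanLin_transpose,
    ← inner_add_left, hcp, inner_toEuclideanLin_transpose, toEuclideanLin_projX_sumEquivProd_symm]

theorem exists_inner_le_of_mem_polarSet_setStep (hC : IsProperCSet C) :
    ∃ s ≥ (0 : ℝ), ∀ P, IsCSet (polarSet P) → ∀ q ∈ polarSet (setStep A B C P),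
      ∃ p ∈ polarSet P, ∀ x u, inner ℝ q x ≤ s * ‖(x, u)‖ +
        inner ℝ p (Matrix.toEuclideanLin A x + Matrix.toEuclideanLin B u) := by
  let pair : Vec (Fin n) × Vec (Fin m) →L[ℝ] Vec (Fin n ⊕ Fin m) :=
    EuclideanSpace.sumEquivProd.symm.toContinuousLinearMap
  obtain ⟨r, hr, hCr⟩ := (isCSet_polarSet hC.2).1.isBounded.exists_pos_norm_le
  refine ⟨r * ‖pair‖, by positivity, fun P hP q hq => ?_⟩
  obtain ⟨c, hc, p, hp, hqcp⟩ := exists_inner_eq_add_of_mem_polarSet_setStep hC hP hq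
  refine ⟨p, hp, fun x u => (hqcp (x, u)).trans_le ?_⟩
  gcongr
  calc inner ℝ c (pair (x, u)) ≤ ‖c‖ * ‖pair (x, u)‖ := real_inner_le_norm _ _
    _ ≤ r * (‖pair‖ * ‖(x, u)‖) := by gcongr; exacts [hCr c hc, pair.le_opNorm _]
    _ = r * ‖pair‖ * ‖(x, u)‖ := (mul_assoc _ _ _).symm

theorem isCSet_polarSet_generatorSet (hC : IsProperCSet C) {P₀ : Set (Vec (Fin n))}
    (hP : IsCSet (polarSet P₀)) : ∀ k, IsCSet (polarSet (generatorSet A B C P₀ k))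
  | 0 => hP
  | k + 1 => isCSet_polarSet (isProperCSet_setStep hC (isCSet_polarSet_generatorSet hC hP k)).2

theorem isProperCSet_generatorSet_succ (hC : IsProperCSet C) {P₀ : Set (Vec (Fin n))}
    (hP : IsCSet (polarSet P₀)) (k : ℕ) : IsProperCSet (generatorSet A B C P₀ (k + 1)) :=
  isProperCSet_setStep hC (isCSet_polarSet_generatorSet hC hP k)

theorem generatorSet_succ_subset {P₀ P₀' : Set (Vec (Fin n))} (h : polarSet P₀' ⊆ polarSet P₀) :
    ∀ k, generatorSet A B C P₀ (k + 1) ⊆ generatorSet A B C P₀' (k + 1)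
  | 0 => setStep_subset_setStep h
  | k + 1 => setStep_subset_setStep (polarSet_anti (generatorSet_succ_subset h k))

theorem generatorSet_setStep (P₀ : Set (Vec (Fin n))) :
    ∀ k, generatorSet A B C (setStep A B C P₀) k = generatorSet A B C P₀ (k + 1)
  | 0 => rfl
  | k + 1 => congrArg (setStep A B C) (generatorSet_setStep P₀ k)

theorem monotone_generatorSet_succ {P₀ : Set (Vec (Fin n))}
    (h : polarSet (generatorSet A B C P₀ 1) ⊆ polarSet P₀) :
    Monotone fun k => generatorSet A B C P₀ (k + 1) :=
  monotone_nat_of_le_succ fun k =>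
    (generatorSet_succ_subset h k).trans_eq (generatorSet_setStep P₀ (k + 1))

theorem antitone_generatorSet_succ {P₀ : Set (Vec (Fin n))}
    (h : polarSet P₀ ⊆ polarSet (generatorSet A B C P₀ 1)) :
    Antitone fun k => generatorSet A B C P₀ (k + 1) :=
  antitone_nat_of_succ_le fun k =>
    (generatorSet_setStep P₀ (k + 1)).symm.trans_subset (generatorSet_succ_subset h k)

theorem isBounded_iUnion_polarSet_generatorSet (hAB : IsStrictlyStabilizable A B)
    (hC : IsProperCSet C) {P₀ : Set (Vec (Fin n))} (hP : IsCSet (polarSet P₀)) :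
    Bornology.IsBounded (⋃ k, polarSet (generatorSet A B C P₀ k)) := by
  have hcset := isCSet_polarSet_generatorSet (A := A) (B := B) hC hP
  obtain ⟨s, hs, hbellman⟩ := exists_inner_le_of_mem_polarSet_setStep (A := A) (B := B) hC
  exact isBounded_iUnion_of_inner_le (controllableSubspace_le_comap A B)
    (controllableSubspace_eq_iSup_range A B).le hAB (fun k => (hcset k).1.isBounded) hs
    fun k => hbellman _ (hcset k)

end Dynamics

section Limits

variable {n m : ℕ} {A : Matrix (Fin n) (Fin n) ℝ} {B : Matrix (Fin n) (Fin m) ℝ}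
  {C : Set (Vec (Fin n ⊕ Fin m))} {P₀ : Set (Vec (Fin n))}

theorem isProperCSet_iInter_generatorSet_succ (hAB : IsStrictlyStabilizable A B)
    (hC : IsProperCSet C) (hP : IsCSet (polarSet P₀)) :
    IsProperCSet (⋂ k, generatorSet A B C P₀ (k + 1)) := by
  have hproper := isProperCSet_generatorSet_succ (A := A) (B := B) hC hP
  refine ⟨⟨(hproper 0).1.1.of_isClosed_subset (isClosed_iInter fun k => (hproper k).1.1.isClosed)
    (Set.iInter_subset _ 0), convex_iInter fun k => (hproper k).1.2.1,
    Set.mem_iInter.2 fun k => (hproper k).1.2.2⟩, ?_⟩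
  have hbipolar : ⋂ k, generatorSet A B C P₀ (k + 1) =
      polarSet (⋃ k, polarSet (generatorSet A B C P₀ (k + 1))) := by
    simp only [polarSet_iUnion, (hproper _).1.polarSet_polarSet]
  exact hbipolar ▸ zero_mem_interior_polarSet <|
    (isBounded_iUnion_polarSet_generatorSet hAB hC hP).subset <|
      Set.iUnion_mono' fun k => ⟨k + 1, subset_rfl⟩

theorem isProperCSet_closure_iUnion_generatorSet_succ (hC : IsProperCSet C)
    (hP : IsCSet (polarSet P₀)) (hmono : Monotone fun k => generatorSet A B C P₀ (k + 1)) :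
    IsProperCSet (closure (⋃ k, generatorSet A B C P₀ (k + 1))) := by
  have hproper := isProperCSet_generatorSet_succ (A := A) (B := B) hC hP
  have hsubset : generatorSet A B C P₀ 1 ⊆ closure (⋃ k, generatorSet A B C P₀ (k + 1)) :=
    (Set.subset_iUnion (fun k => generatorSet A B C P₀ (k + 1)) 0).trans subset_closure
  have hcompact : IsCompact (closure (⋃ k, generatorSet A B C P₀ (k + 1))) :=
    (hC.1.matImage (projX n m)).1.closure_of_subset <|
      Set.iUnion_subset fun k => setStep_subset_matImage_projX hC.1 _
  exact ⟨⟨hcompact, (hmono.directed_le.convex_iUnion fun k => (hproper k).1.2.1).closure,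
    hsubset (hproper 0).1.2.2⟩, interior_mono hsubset (hproper 0).2⟩

theorem exists_hausdorffConverges_generatorSet (hAB : IsStrictlyStabilizable A B)
    (hC : IsProperCSet C) (hP : IsCSet (polarSet P₀))
    (h : polarSet P₀ ⊆ polarSet (generatorSet A B C P₀ 1) ∨
      polarSet (generatorSet A B C P₀ 1) ⊆ polarSet P₀) :
    ∃ P, IsProperCSet P ∧ HausdorffConverges (fun k => generatorSet A B C P₀ (k + 1)) P := by
  obtain h | h := h
  · have hlim := isProperCSet_iInter_generatorSet_succ hAB hC hP
    exact ⟨_, hlim, ⟨0, hlim.1.2.2⟩, hlim.1.1,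
      tendsto_hausdorffEDist_iInter_of_antitone (antitone_generatorSet_succ h)
        fun k => (isProperCSet_generatorSet_succ hC hP k).1.1⟩
  · have hmono := monotone_generatorSet_succ h
    have hlim := isProperCSet_closure_iUnion_generatorSet_succ hC hP hmono
    exact ⟨_, hlim, ⟨0, hlim.1.2.2⟩, hlim.1.1,
      tendsto_hausdorffEDist_closure_iUnion_of_monotone hmono hlim.1.1⟩

end Limits

end MinkowskiBellman

theorem theorem4p2 {n m : ℕ}
    (A : Matrix (Fin n) (Fin n) ℝ) (B : Matrix (Fin n) (Fin m) ℝ)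
    (C : Set (MinkowskiBellman.Vec (Fin n ⊕ Fin m)))
    (hAB : MinkowskiBellman.IsStrictlyStabilizable A B)
    (hC : MinkowskiBellman.IsProperCSet C)
    (P₀' P₀'' : Set (MinkowskiBellman.Vec (Fin n)))
    (hP' : MinkowskiBellman.IsCSet (MinkowskiBellman.polarSet P₀'))
    (hP'' : MinkowskiBellman.IsCSet (MinkowskiBellman.polarSet P₀''))
    (hI : MinkowskiBellman.polarSet P₀'' ⊆ MinkowskiBellman.polarSet P₀')
    (hII :
      MinkowskiBellman.polarSet P₀' ⊆
          MinkowskiBellman.polarSet (MinkowskiBellman.generatorSet A B C P₀' 1) ∨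
        MinkowskiBellman.polarSet (MinkowskiBellman.generatorSet A B C P₀' 1) ⊆
          MinkowskiBellman.polarSet P₀')
    (hIII :
      MinkowskiBellman.polarSet P₀'' ⊆
          MinkowskiBellman.polarSet (MinkowskiBellman.generatorSet A B C P₀'' 1) ∨
        MinkowskiBellman.polarSet (MinkowskiBellman.generatorSet A B C P₀'' 1) ⊆
          MinkowskiBellman.polarSet P₀'') :
    -- the limits exist and are proper `C`-sets
    (∃ P' : Set (MinkowskiBellman.Vec (Fin n)), MinkowskiBellman.IsProperCSet P' ∧
      MinkowskiBellman.HausdorffConverges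
        (fun k => MinkowskiBellman.generatorSet A B C P₀' (k + 1)) P') ∧
    (∃ P'' : Set (MinkowskiBellman.Vec (Fin n)), MinkowskiBellman.IsProperCSet P'' ∧
      MinkowskiBellman.HausdorffConverges
        (fun k => MinkowskiBellman.generatorSet A B C P₀'' (k + 1)) P'') ∧
    -- and they are ordered
    ∀ P' P'' : Set (MinkowskiBellman.Vec (Fin n)),
      MinkowskiBellman.HausdorffConverges
        (fun k => MinkowskiBellman.generatorSet A B C P₀' (k + 1)) P' →
      MinkowskiBellman.HausdorffConverges
        (fun k => MinkowskiBellman.generatorSet A B C P₀'' (k + 1)) P'' →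
      P' ⊆ P'' :=
  ⟨MinkowskiBellman.exists_hausdorffConverges_generatorSet hAB hC hP' hII,
    MinkowskiBellman.exists_hausdorffConverges_generatorSet hAB hC hP'' hIII,
    fun _ _ h' h'' => h'.subset h'' (MinkowskiBellman.generatorSet_succ_subset hI)⟩
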